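/- There is a universal constant $C<\infty$ such that the following holds. Let $P$ be a probability measure on a measurable space $(\mathcal X,\mathcal A)$, let $n\ge 1$, and let $X_1,\dots,X_n$ be the coordinate projections on $(\mathcal X^n,\mathcal A^n,P^n)$. Write $Pf=\int f\,dP$, $\|f\|_{Q,2}=(\int f^2\,dQ)^{1/2}$, $\mathbb G_nf=n^{-1/2}\sum_{i=1}^n(f(X_i)-Pf)$ and $\|\mathbb G_n\|_{\mathcal F}=\sup_{f\in\mathcal F}|\mathbb G_nf|$, and let $\mathrm E_P^*$ denote outer expectation under $P^n$, that is, $\mathrm E_P^*Z=\inf\{\mathrm E\,U: U\ge Z,\ U\text{ measurable}\}$. Call a class $\mathcal F$ of functions $f:\mathcal X\to\mathbb R$ *$P$-measurable* if for every $m$ and all $e_1,\dots,e_m\in\{-1,1\}$ the map $(x_1,\dots,x_m)\mapsto\sup_{f\in\mathcal F}\bigl|\sum_{i=1}^m e_if(x_i)\bigr|$ is measurable on the completion of $(\mathcal X^m,\mathcal A^m,P^m)$. Let $\mathcal F$ be a $P$-measurable class of measurable functions $f:\mathcal X\to\mathbb R$ such that $\mathcal F^2=\{f^2:f\in\mathcal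 F\}$ is also $P$-measurable, and let $F:\mathcal X\to\mathbb R$ be a measurable envelope function, that is, $|f|\le F$ for every $f\in\mathcal F$, with $F\le 1$. Let $$J(\delta,\mathcal F,L_2)=\sup_Q\int_0^\delta\sqrt{1+\log N\bigl(\varepsilon\|F\|_{Q,2},\mathcal F,L_2(Q)\bigr)}\,d\varepsilon\in[0,\infty],$$ where the supremum is over all finitely discrete probability distributions $Q$ on $(\mathcal X,\mathcal A)$ and $N(r,\mathcal F,L_2(Q))$ is the minimal number of closed balls of radius $r$ in $L_2(Q)$ (with centres anywhere in $L_2(Q)$) needed to cover $\mathcal F$. If $\delta\in(0,1)$ and $Pf^2<\delta^2PF^2$ for every $f\in\mathcal F$, then $$\mathrm E_P^*\|\mathbb G_n\|_{\mathcal F}\le C\,J(\delta,\mathcal F,L_2)\Bigl(1+\frac{J(\delta,\mathcal F,L_2)}{\delta^2\sqrt n\,\|F\|_{P,2}}\Bigr)\|F\|_{P,2}.$$ -/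

import Mathlib

open MeasureTheory Set
open scoped ENNReal NNReal

namespace EmpProc

noncomputable section

/-- The empirical process `𝔾ₙ f = n^{-1/2} ∑ᵢ (f(Xᵢ) - P f)`, as a function of the sample
`x = (X₁, …, Xₙ)`. -/
def empProc {X : Type*} [MeasurableSpace X] (P : Measure X) (n : ℕ) (f : X → ℝ)
    (x : Fin n → X) : ℝ :=
  (1 / √(n : ℝ)) * ∑ i, (f (x i) - ∫ y, f y ∂P)

/-- `‖𝔾ₙ‖_𝓕 = sup_{f ∈ 𝓕} |𝔾ₙ f|`, with values in `[0, ∞]`. -/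
def empiricalSup {X : Type*} [MeasurableSpace X] (P : Measure X) (n : ℕ) (𝓕 : Set (X → ℝ))
    (x : Fin n → X) : ℝ≥0∞ :=
  ⨆ f ∈ 𝓕, ENNReal.ofReal |empProc P n f x|

/-- The outer expectation `E* Z` of an arbitrary, not necessarily measurable, map
`Z : Ω → [0, ∞]`: the infimum of `E U` over all measurable `U ≥ Z`.
(The lower Lebesgue integral `∫⁻` is a different quantity when `Z` is not measurable.) -/
def outerExpectation {Ω : Type*} [MeasurableSpace Ω] (μ : Measure Ω) (Z : Ω → ℝ≥0∞) : ℝ≥0∞ :=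
  ⨅ (U : Ω → ℝ≥0∞) (_ : Measurable U) (_ : ∀ ω, Z ω ≤ U ω), ∫⁻ ω, U ω ∂μ

/-- A class `𝓕` is `P`-measurable if for all `n` and all signs `e₁, …, eₙ ∈ {-1, 1}` the map
`(X₁, …, Xₙ) ↦ sup_{f ∈ 𝓕} |∑ᵢ eᵢ f(Xᵢ)|` is measurable for the completion of `Pⁿ`. -/
def PMeasurable {X : Type*} [MeasurableSpace X] (P : Measure X) (𝓕 : Set (X → ℝ)) : Prop :=
  ∀ (n : ℕ) (e : Fin n → ℝ), (∀ i, e i = -1 ∨ e i = 1) →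
    NullMeasurable (fun x : Fin n → X => ⨆ f ∈ 𝓕, ENNReal.ofReal |∑ i, e i * f (x i)|)
      (Measure.pi fun _ : Fin n => P)

/-- `𝓕² = {f² : f ∈ 𝓕}`. -/
def sqClass {X : Type*} (𝓕 : Set (X → ℝ)) : Set (X → ℝ) :=
  {g | ∃ f ∈ 𝓕, g = fun x => f x ^ 2}

/-- `Fenv` is an envelope function of `𝓕`. -/
def IsEnvelope {X : Type*} [MeasurableSpace X] (𝓕 : Set (X → ℝ)) (Fenv : X → ℝ) : Prop :=
  Measurable Fenv ∧ ∀ f ∈ 𝓕, ∀ x, |f x| ≤ Fenv x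

/-- A finitely discrete probability distribution: a probability measure that is a finite
weighted sum of point masses. -/
def IsFinitelyDiscrete {X : Type*} [MeasurableSpace X] (Q : Measure X) : Prop :=
  IsProbabilityMeasure Q ∧
    ∃ (s : Finset X) (w : X → ℝ≥0∞), Q = ∑ x ∈ s, w x • Measure.dirac x

/-- The covering number `N(r, 𝓕, L₂(Q))`: the minimal number of balls of radius `r` in `L₂(Q)`,
with arbitrary centres in `L₂(Q)`, that cover (the classes in `L₂(Q)` of) the functions in `𝓕`. -/
def coveringL2 {X : Type*} [MeasurableSpace X] (Q : Measure X) (𝓕 : Set (X → ℝ)) (r : ℝ≥0) :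
    ℕ∞ :=
  Metric.externalCoveringNumber r {u : Lp ℝ 2 Q | ∃ f ∈ 𝓕, u =ᵐ[Q] f}

/-- `√(1 + log N)` for `N ∈ ℕ ∪ {∞}`, equal to `∞` for `N = ∞`. -/
def sqrtEntropy (N : ℕ∞) : ℝ≥0∞ :=
  (1 + ENNReal.log (N : ℝ≥0∞)).toENNReal ^ (1 / 2 : ℝ)

/-- The uniform entropy integral
`J(δ, 𝓕 | Fenv, L₂) = sup_Q ∫₀^δ √(1 + log N(ε ‖Fenv‖_{Q,2}, 𝓕, L₂(Q))) dε`,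
the supremum being over all finitely discrete probability distributions `Q`. -/
def uniformEntropyIntegral {X : Type*} [MeasurableSpace X] (δ : ℝ) (𝓕 : Set (X → ℝ))
    (Fenv : X → ℝ) : ℝ≥0∞ :=
  ⨆ (Q : Measure X) (_ : IsFinitelyDiscrete Q),
    ∫⁻ ε in Ioo (0 : ℝ) δ,
      sqrtEntropy (coveringL2 Q 𝓕 (ε.toNNReal * (eLpNorm Fenv 2 Q).toNNReal))

end

end EmpProc

namespace EmpProc

section Symmetrization

variable {X : Type*} [MeasurableSpace X]

/-- `sup_{g ∈ 𝓖} |∑ᵢ eᵢ g(xᵢ)|`. -/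
noncomputable def signSup {ι : Type*} [Fintype ι] (𝓖 : Set (X → ℝ)) (e : ι → ℝ) (x : ι → X) :
    ℝ≥0∞ :=
  ⨆ g ∈ 𝓖, ENNReal.ofReal |∑ i, e i * g (x i)|

lemma PMeasurable.aemeasurable_signSup {P : Measure X} [IsProbabilityMeasure P]
    {𝓖 : Set (X → ℝ)} (h : PMeasurable P 𝓖) {ι : Type*} [Fintype ι] {e : ι → ℝ}
    (he : ∀ i, e i = -1 ∨ e i = 1) :
    AEMeasurable (signSup 𝓖 e) (Measure.pi fun _ : ι => P) := by
  set σ := Fintype.equivFin ι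
  have h1 : AEMeasurable (signSup 𝓖 (fun k => e (σ.symm k)))
      (Measure.pi fun _ : Fin (Fintype.card ι) => P) :=
    (h _ (fun k => e (σ.symm k)) (fun k => he _)).aemeasurable
  have h2 := h1.comp_quasiMeasurePreserving
    (measurePreserving_piCongrLeft (α := fun _ => X) (fun _ => P) σ).quasiMeasurePreserving
  refine h2.congr (Filter.Eventually.of_forall fun x => ?_)
  simp only [signSup, Function.comp_apply]
  congr! 5 with g hg
  rw [← σ.sum_comp]
  refine Finset.sum_congr rfl fun i _ => ?_
  rw [σ.symm_apply_apply, MeasurableEquiv.coe_piCongrLeft]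
  congr 2
  exact Equiv.piCongrLeft_apply_apply (fun _ => X) σ x i

lemma lintegral_signSup_comp_perm (P : Measure X) [IsProbabilityMeasure P] (𝓖 : Set (X → ℝ))
    {ι : Type*} [Fintype ι] (e : ι → ℝ) (σ : Equiv.Perm ι) :
    ∫⁻ x, signSup 𝓖 (e ∘ σ) x ∂(Measure.pi fun _ : ι => P) =
      ∫⁻ x, signSup 𝓖 e x ∂(Measure.pi fun _ : ι => P) := by
  have hmp := measurePreserving_piCongrLeft (α := fun _ => X) (fun _ => P) σ
  refine Eq.trans ?_ (hmp.lintegral_map_equiv _ _).symm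
  refine lintegral_congr fun x => ?_
  simp only [signSup]
  congr! 5 with g hg
  refine Eq.trans ?_ (Equiv.sum_comp σ fun k => e k *
    g (MeasurableEquiv.piCongrLeft (fun _ => X) σ x k))
  refine Finset.sum_congr rfl fun i _ => ?_
  rw [MeasurableEquiv.coe_piCongrLeft, Function.comp_apply]
  congr 2
  exact (Equiv.piCongrLeft_apply_apply (fun _ => X) σ x i).symm

/-- The permutation of `ι ⊕ ι` exchanging the two copies of `i` whenever `s i`. -/
def swapPerm {ι : Type*} (s : ι → Prop) [DecidablePred s] : Equiv.Perm (ι ⊕ ι) where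
  toFun := Sum.elim (fun i => if s i then .inr i else .inl i)
    (fun i => if s i then .inl i else .inr i)
  invFun := Sum.elim (fun i => if s i then .inr i else .inl i)
    (fun i => if s i then .inl i else .inr i)
  left_inv := by rintro (i | i) <;> by_cases h : s i <;> simp [h]
  right_inv := by rintro (i | i) <;> by_cases h : s i <;> simp [h]

lemma exists_measurable_ge_ae_eq {Ω : Type*} [MeasurableSpace Ω] {μ : Measure Ω} {T : Ω → ℝ≥0∞}
    (hT : AEMeasurable T μ) : ∃ U, Measurable U ∧ (∀ ω, T ω ≤ U ω) ∧ U =ᵐ[μ] T := by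
  classical
  set s := toMeasurable μ {ω | T ω ≠ hT.mk T ω} with hs
  have hs0 : μ s = 0 := by
    rw [hs, measure_toMeasurable]; exact hT.ae_eq_mk
  have hsm : MeasurableSet s := measurableSet_toMeasurable _ _
  refine ⟨s.piecewise (fun _ => ⊤) (hT.mk T), Measurable.piecewise hsm measurable_const
    hT.measurable_mk, fun ω => ?_, ?_⟩
  · by_cases h : ω ∈ s
    · simp [h]
    · have : T ω = hT.mk T ω := by
        by_contra hne
        exact h (subset_toMeasurable μ _ hne)
      simp [h, this]
  · have h1 : ∀ᵐ ω ∂μ, ω ∉ s := measure_eq_zero_iff_ae_notMem.1 hs0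
    filter_upwards [h1, hT.ae_eq_mk] with ω h1 h2
    simp [h1, h2]

/-- Symmetrization inequality, for an arbitrary fixed choice of signs. -/
lemma outerExpectation_empiricalSup_le {P : Measure X} [IsProbabilityMeasure P]
    {𝓖 : Set (X → ℝ)} (hm : ∀ g ∈ 𝓖, Measurable g) (hb : ∀ g ∈ 𝓖, ∀ x, |g x| ≤ 1)
    (hP : PMeasurable P 𝓖) {n : ℕ} {e : Fin n → ℝ} (he : ∀ i, e i = -1 ∨ e i = 1) :
    outerExpectation (Measure.pi fun _ : Fin n => P) (empiricalSup P n 𝓖) ≤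
      ENNReal.ofReal (1 / √(n : ℝ)) *
        (2 * ∫⁻ x, signSup 𝓖 e x ∂(Measure.pi fun _ : Fin n => P)) := by
  classical
  set μ := Measure.pi fun _ : Fin n => P with hμ
  set E := MeasurableEquiv.sumPiEquivProdPi (fun _ : Fin n ⊕ Fin n => X) with hE
  have hEmp : MeasurePreserving E (Measure.pi fun _ : Fin n ⊕ Fin n => P) (μ.prod μ) :=
    measurePreserving_sumPiEquivProdPi (fun _ : Fin n ⊕ Fin n => P)
  set d : Fin n ⊕ Fin n → ℝ := Sum.elim (fun _ => 1) (fun _ => -1) with hd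
  have hd1 : ∀ k, d k = -1 ∨ d k = 1 := by rintro (i | i) <;> simp [hd]
  have hT : AEMeasurable (fun p => signSup 𝓖 d (E.symm p)) (μ.prod μ) :=
    (hP.aemeasurable_signSup hd1).comp_quasiMeasurePreserving
      (hEmp.symm E).quasiMeasurePreserving
  obtain ⟨V, hVm, hVge, hVeq⟩ := exists_measurable_ge_ae_eq hT
  have hsum : ∀ (g : X → ℝ) (c : Fin n ⊕ Fin n → ℝ) (x y : Fin n → X),
      ∑ k, c k * g (E.symm (x, y) k) =
        ∑ i, c (.inl i) * g (x i) + ∑ i, c (.inr i) * g (y i) := by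
    intro g c x y
    rw [Fintype.sum_sum_type]
    rfl
  -- The outer expectation is bounded through the partial integrals of `V`
  have hle : ∀ x, empiricalSup P n 𝓖 x ≤
      ENNReal.ofReal (1 / √(n : ℝ)) * ∫⁻ y, V (x, y) ∂μ := by
    intro x
    refine iSup₂_le fun g hg => ?_
    rw [empProc, abs_mul, abs_of_nonneg (by positivity : (0 : ℝ) ≤ 1 / √(n : ℝ)),
      ENNReal.ofReal_mul (by positivity)]
    gcongr
    have hgi : Integrable g P :=
      Integrable.of_bound (hm g hg).aestronglyMeasurable 1
        (Filter.Eventually.of_forall fun x => hb g hg x)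
    have hgi' : ∀ i, Integrable (fun y : Fin n → X => g (y i)) μ := fun i =>
      (measurePreserving_eval (fun _ : Fin n => P) i).integrable_comp_of_integrable hgi
    have hint : ∑ i, (g (x i) - ∫ z, g z ∂P) = ∫ y, ∑ i, (g (x i) - g (y i)) ∂μ := by
      rw [integral_finsetSum Finset.univ (f := fun i (y : Fin n → X) => g (x i) - g (y i))
        fun i _ => (integrable_const _).sub (hgi' i)]
      refine Finset.sum_congr rfl fun i _ => ?_
      rw [integral_sub (integrable_const _) (hgi' i)]
      have := (measurePreserving_eval (fun _ : Fin n => P) i)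
      have h2 : ∫ y, g (y i) ∂μ = ∫ z, g z ∂P := by
        rw [← this.map_eq, integral_map (measurable_pi_apply i).aemeasurable
          (hm g hg).aestronglyMeasurable]
      rw [h2]
      simp
    rw [hint, ← Real.enorm_eq_ofReal_abs]
    refine (enorm_integral_le_lintegral_enorm _).trans (lintegral_mono fun y => ?_)
    refine le_trans ?_ (hVge (x, y))
    refine le_trans ?_ (le_iSup₂ (f := fun g (_ : g ∈ 𝓖) =>
      ENNReal.ofReal |∑ k, d k * g (E.symm (x, y) k)|) g hg)
    rw [hsum, Real.enorm_eq_ofReal_abs]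
    refine le_of_eq ?_
    congr 2
    simp [hd, sub_eq_add_neg, Finset.sum_add_distrib]
  have hVint : Measurable fun x => ENNReal.ofReal (1 / √(n : ℝ)) * ∫⁻ y, V (x, y) ∂μ :=
    hVm.lintegral_prod_right'.const_mul _
  refine (iInf₂_le _ hVint).trans ((iInf_le _ hle).trans ?_)
  rw [lintegral_const_mul _ hVm.lintegral_prod_right']
  gcongr
  rw [← lintegral_prod _ hVm.aemeasurable, lintegral_congr_ae hVeq,
    (hEmp.symm E).lintegral_comp_emb E.symm.measurableEmbedding]
  -- Exchange coordinates to introduce the signs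
  have hperm : ∀ k, (d ∘ swapPerm fun i => e i = -1) k = Sum.elim e (fun i => - e i) k := by
    rintro (i | i) <;> rcases he i with h | h <;> norm_num [hd, swapPerm, h]
  rw [← lintegral_signSup_comp_perm P 𝓖 d (swapPerm fun i => e i = -1), funext hperm,
    hEmp.symm E |>.lintegral_map_equiv]
  have hS : AEMeasurable (signSup 𝓖 e) μ := hP.aemeasurable_signSup he
  calc ∫⁻ p, signSup 𝓖 (Sum.elim e fun i => - e i) (E.symm p) ∂(μ.prod μ)
      ≤ ∫⁻ p, (signSup 𝓖 e p.1 + signSup 𝓖 e p.2) ∂(μ.prod μ) := by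
        refine lintegral_mono fun p => iSup₂_le fun g hg => ?_
        obtain ⟨x, y⟩ := p
        have h1 : ENNReal.ofReal |∑ i, e i * g (x i)| ≤ signSup 𝓖 e x :=
          le_iSup₂ (f := fun g (_ : g ∈ 𝓖) => ENNReal.ofReal |∑ i, e i * g (x i)|) g hg
        have h2 : ENNReal.ofReal |∑ i, e i * g (y i)| ≤ signSup 𝓖 e y :=
          le_iSup₂ (f := fun g (_ : g ∈ 𝓖) => ENNReal.ofReal |∑ i, e i * g (y i)|) g hg
        refine le_trans ?_ (add_le_add h1 h2)
        rw [← ENNReal.ofReal_add (abs_nonneg _) (abs_nonneg _), hsum]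
        refine ENNReal.ofReal_le_ofReal ?_
        simp only [Sum.elim_inl, Sum.elim_inr, neg_mul, Finset.sum_neg_distrib, ← sub_eq_add_neg]
        exact abs_sub _ _
    _ = 2 * ∫⁻ x, signSup 𝓖 e x ∂μ := by
        have hf : AEMeasurable (fun p : (Fin n → X) × (Fin n → X) => signSup 𝓖 e p.1)
            (μ.prod μ) := hS.comp_quasiMeasurePreserving
          (Measure.quasiMeasurePreserving_fst (μ := μ) (ν := μ))
        rw [lintegral_add_left' hf, two_mul]
        congr 1
        · rw [lintegral_prod _ hf]
          simp
        · have hs : AEMeasurable (fun p : (Fin n → X) × (Fin n → X) => signSup 𝓖 e p.2)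
              (μ.prod μ) := hS.comp_quasiMeasurePreserving
            (Measure.quasiMeasurePreserving_snd (μ := μ) (ν := μ))
          rw [lintegral_prod _ hs]
          simp

end Symmetrization

/-- The Rademacher sign `±1` attached to a Boolean. -/
def rad (b : Bool) : ℝ := if b then 1 else -1

lemma rad_eq (b : Bool) : rad b = -1 ∨ rad b = 1 := by
  cases b <;> simp [rad]

lemma abs_rad (b : Bool) : |rad b| = 1 := by
  cases b <;> simp [rad]

section Maximal

variable {ι : Type*} [Fintype ι]

/-- The Rademacher sum `∑ᵢ eᵢ aᵢ`. -/
def radSum (e : ι → Bool) (a : EuclideanSpace ℝ ι) : ℝ := ∑ i, rad (e i) * a i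

lemma radSum_sub (e : ι → Bool) (a b : EuclideanSpace ℝ ι) :
    radSum e (a - b) = radSum e a - radSum e b := by
  simp [radSum, mul_sub, Finset.sum_sub_distrib]

lemma radSum_zero (e : ι → Bool) : radSum e (0 : EuclideanSpace ℝ ι) = 0 := by
  simp [radSum]

lemma abs_radSum_le (e : ι → Bool) (a : EuclideanSpace ℝ ι) :
    |radSum e a| ≤ Fintype.card ι * ‖a‖ := by
  calc |radSum e a| ≤ ∑ i, |rad (e i) * a i| := Finset.abs_sum_le_sum_abs _ _
    _ ≤ ∑ _i : ι, ‖a‖ := by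
        refine Finset.sum_le_sum fun i _ => ?_
        rw [abs_mul, abs_rad, one_mul]
        exact PiLp.norm_apply_le a i
    _ = Fintype.card ι * ‖a‖ := by simp

lemma sum_exp_radSum_le (a : EuclideanSpace ℝ ι) (c : ℝ) [DecidableEq ι] :
    ∑ e : ι → Bool, Real.exp (c * radSum e a) ≤
      2 ^ Fintype.card ι * Real.exp (c ^ 2 * ‖a‖ ^ 2 / 2) := by
  have h1 : ∀ e : ι → Bool, Real.exp (c * radSum e a) = ∏ i, Real.exp (rad (e i) * (c * a i)) := by
    intro e
    rw [← Real.exp_sum, radSum, Finset.mul_sum]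
    congr 1
    exact Finset.sum_congr rfl fun i _ => by ring
  have h2 : ∑ e : ι → Bool, Real.exp (c * radSum e a) = ∏ i : ι, (2 * Real.cosh (c * a i)) := by
    simp_rw [h1]
    have := Finset.prod_univ_sum (fun _ : ι => (Finset.univ : Finset Bool))
      (fun i b => Real.exp (rad b * (c * a i)))
    rw [Fintype.piFinset_univ] at this
    rw [← this]
    refine Finset.prod_congr rfl fun i _ => ?_
    rw [Real.cosh_eq]
    simp [rad]
    ring
  rw [h2, Finset.prod_mul_distrib, Finset.prod_const, Finset.card_univ]
  refine mul_le_mul_of_nonneg_left ?_ (by positivity)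
  calc ∏ i, Real.cosh (c * a i) ≤ ∏ i, Real.exp ((c * a i) ^ 2 / 2) :=
        Finset.prod_le_prod (fun i _ => (Real.cosh_pos _).le) fun i _ => Real.cosh_le_exp_half_sq _
    _ = Real.exp (c ^ 2 * ‖a‖ ^ 2 / 2) := by
        rw [← Real.exp_sum, EuclideanSpace.real_norm_sq_eq, Finset.mul_sum, Finset.sum_div]
        congr 1
        exact Finset.sum_congr rfl fun i _ => by ring

/-- Maximal inequality for finitely many Rademacher sums. -/
lemma sum_max_radSum_le {A : Finset (EuclideanSpace ℝ ι)} {R : ℝ} (hR : 0 < R)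
    (hA : ∀ a ∈ A, ‖a‖ ≤ R) {N : ℕ} (hN : 1 ≤ N) (hAN : A.card ≤ N ^ 2)
    {M : (ι → Bool) → ℝ} [DecidableEq ι] (hM : ∀ e, ∃ a ∈ A, M e ≤ |radSum e a|) :
    ∑ e, M e ≤ 2 ^ Fintype.card ι * (3 * R * √(1 + Real.log N)) := by
  set s := √(1 + Real.log N) with hs
  have hlog : 0 ≤ Real.log N := Real.log_nonneg (by exact_mod_cast hN)
  have hs2 : s ^ 2 = 1 + Real.log N := Real.sq_sqrt (by linarith)
  have hspos : 0 < s := Real.sqrt_pos.2 (by linarith)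
  set c := s / R with hc
  have hcpos : 0 < c := div_pos hspos hR
  set K : ℝ := 2 ^ Fintype.card ι with hK
  have hKpos : 0 < K := by positivity
  set T := Real.log (2 * (N : ℝ) ^ 2) + c ^ 2 * R ^ 2 / 2 with hT
  have hNpos : (0 : ℝ) < N := by exact_mod_cast hN
  have hexp : ∑ e, Real.exp (c * M e) ≤ K * Real.exp T := by
    calc ∑ e, Real.exp (c * M e)
        ≤ ∑ e : ι → Bool, ∑ a ∈ A, (Real.exp (c * radSum e a) + Real.exp ((-c) * radSum e a)) := by
          refine Finset.sum_le_sum fun e _ => ?_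
          obtain ⟨a, ha, h⟩ := hM e
          refine le_trans ?_ (Finset.single_le_sum (f := fun a => Real.exp (c * radSum e a) +
            Real.exp ((-c) * radSum e a)) (fun _ _ => by positivity) ha)
          rcases le_total 0 (radSum e a) with h0 | h0
          · rw [abs_of_nonneg h0] at h
            have : Real.exp (c * M e) ≤ Real.exp (c * radSum e a) := by gcongr
            have := Real.exp_pos ((-c) * radSum e a)
            linarith
          · rw [abs_of_nonpos h0] at h
            have : Real.exp (c * M e) ≤ Real.exp ((-c) * radSum e a) := by
              rw [neg_mul, ← mul_neg]; gcongr
            have := Real.exp_pos (c * radSum e a)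
            linarith
      _ = ∑ a ∈ A, (∑ e : ι → Bool, Real.exp (c * radSum e a) +
            ∑ e : ι → Bool, Real.exp ((-c) * radSum e a)) := by
          rw [Finset.sum_comm]
          simp_rw [Finset.sum_add_distrib]
      _ ≤ ∑ _a ∈ A, 2 * (K * Real.exp (c ^ 2 * R ^ 2 / 2)) := by
          refine Finset.sum_le_sum fun a ha => ?_
          have h1 := sum_exp_radSum_le a c
          have h2 := sum_exp_radSum_le a (-c)
          rw [neg_sq] at h2
          have h3 : Real.exp (c ^ 2 * ‖a‖ ^ 2 / 2) ≤ Real.exp (c ^ 2 * R ^ 2 / 2) := by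
            have := hA a ha
            gcongr
          have h4 := mul_le_mul_of_nonneg_left h3 hKpos.le
          linarith
      _ = (A.card : ℝ) * (2 * (K * Real.exp (c ^ 2 * R ^ 2 / 2))) := by simp
      _ ≤ (N : ℝ) ^ 2 * (2 * (K * Real.exp (c ^ 2 * R ^ 2 / 2))) := by
          refine mul_le_mul_of_nonneg_right ?_ (by positivity)
          exact_mod_cast hAN
      _ = K * Real.exp T := by
          rw [hT, Real.exp_add, Real.exp_log (by positivity)]
          ring
  have htan : ∑ e, Real.exp T * (1 + c * M e - T) ≤ ∑ e, Real.exp (c * M e) := by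
    refine Finset.sum_le_sum fun e _ => ?_
    have h := Real.add_one_le_exp (c * M e - T)
    have : Real.exp (c * M e) = Real.exp T * Real.exp (c * M e - T) := by
      rw [← Real.exp_add]; congr 1; ring
    rw [this]
    refine mul_le_mul_of_nonneg_left (by linarith) (Real.exp_pos _).le
  have hcard : ((Finset.univ : Finset (ι → Bool)).card : ℝ) = K := by
    simp [hK]
  have hsum : ∑ e, Real.exp T * (1 + c * M e - T) =
      Real.exp T * (K * (1 - T) + c * ∑ e, M e) := by
    rw [← Finset.mul_sum, Finset.mul_sum Finset.univ M c, ← hcard]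
    congr 1
    have : ∀ e, 1 + c * M e - T = (1 - T) + c * M e := fun e => by ring
    simp_rw [this, Finset.sum_add_distrib, Finset.sum_const, nsmul_eq_mul]
  have hmain : c * ∑ e, M e ≤ K * T := by
    have h := htan.trans hexp
    rw [hsum, mul_comm K (Real.exp T)] at h
    have := le_of_mul_le_mul_left h (Real.exp_pos T)
    linarith
  have hTle : T ≤ 3 * s ^ 2 := by
    rw [hT, Real.log_mul (by norm_num) (by positivity), Real.log_pow, hc, div_pow,
      div_mul_cancel₀ _ (by positivity)]
    have := Real.log_two_lt_d9
    push_cast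
    nlinarith
  have h5 : c * ∑ e, M e ≤ c * (K * (3 * R * s)) := by
    have : c * (K * (3 * R * s)) = K * (3 * s ^ 2) := by
      rw [hc]; field_simp
    rw [this]
    exact hmain.trans (mul_le_mul_of_nonneg_left hTle hKpos.le)
  exact le_of_mul_le_mul_left h5 hcpos

lemma sqrtEntropy_natCast {N : ℕ} (hN : 1 ≤ N) :
    sqrtEntropy N = ENNReal.ofReal √(1 + Real.log N) := by
  have hlog : 0 ≤ Real.log N := Real.log_nonneg (by exact_mod_cast hN)
  have h : ENNReal.log ((N : ℕ∞) : ℝ≥0∞) = ((Real.log N : ℝ) : EReal) := by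
    have : (((N : ℕ∞) : ℝ≥0∞)) = ENNReal.ofReal (N : ℝ) := by simp
    rw [this, ENNReal.log_ofReal_of_pos (by exact_mod_cast hN)]
  rw [sqrtEntropy, h, Real.sqrt_eq_rpow, ← ENNReal.ofReal_rpow_of_nonneg (by linarith) (by norm_num)]
  congr 1

lemma sqrtEntropy_mono : Monotone sqrtEntropy := by
  intro a b hab
  unfold sqrtEntropy
  refine ENNReal.rpow_le_rpow ?_ (by norm_num)
  refine EReal.toENNReal_le_toENNReal ?_
  gcongr

lemma sqrtEntropy_top : sqrtEntropy ⊤ = ⊤ := by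
  have : (1 : EReal) + ⊤ = ⊤ := EReal.add_top_of_ne_bot (by decide)
  simp [sqrtEntropy, this]

/-- Maximal inequality for a family of Rademacher sums with values in a finite set. -/
lemma sum_iSup_radSum_le {T : Type*} {v : T → EuclideanSpace ℝ ι}
    {A : Finset (EuclideanSpace ℝ ι)} {R : ℝ} (hR : 0 < R) (hv : ∀ t, v t ∈ A)
    (hA : ∀ t, ‖v t‖ ≤ R) {N : ℕ} (hN : 1 ≤ N) (hAN : A.card ≤ N ^ 2) [DecidableEq ι] :
    ∑ e : ι → Bool, ⨆ t, ENNReal.ofReal |radSum e (v t)| ≤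
      2 ^ Fintype.card ι * (ENNReal.ofReal (3 * R) * sqrtEntropy N) := by
  classical
  rcases isEmpty_or_nonempty T with hT | hT
  · simp
  set A' := A.filter fun a => ‖a‖ ≤ R with hA'
  have hv' : ∀ t, v t ∈ A' := fun t => by simp [hA', hv t, hA t]
  have hne : A'.Nonempty := ⟨_, hv' hT.some⟩
  choose b hb hbmax using fun e : ι → Bool => A'.exists_max_image (fun a => |radSum e a|) hne
  have h := sum_max_radSum_le hR (A := A') (fun a ha => (Finset.mem_filter.1 ha).2) hN
    ((Finset.card_filter_le _ _).trans hAN) (M := fun e => |radSum e (b e)|)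
    (fun e => ⟨b e, hb e, le_rfl⟩)
  calc ∑ e : ι → Bool, ⨆ t, ENNReal.ofReal |radSum e (v t)|
      ≤ ∑ e : ι → Bool, ENNReal.ofReal |radSum e (b e)| :=
        Finset.sum_le_sum fun e _ => iSup_le fun t =>
          ENNReal.ofReal_le_ofReal (hbmax e _ (hv' t))
    _ = ENNReal.ofReal (∑ e : ι → Bool, |radSum e (b e)|) :=
        (ENNReal.ofReal_sum_of_nonneg fun _ _ => abs_nonneg _).symm
    _ ≤ ENNReal.ofReal (2 ^ Fintype.card ι * (3 * R * √(1 + Real.log N))) :=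
        ENNReal.ofReal_le_ofReal h
    _ = _ := by
        rw [sqrtEntropy_natCast hN, ENNReal.ofReal_mul (by positivity),
          ENNReal.ofReal_mul (by positivity), ENNReal.ofReal_pow (by norm_num)]
        simp

/-- Chaining bound for Rademacher sums. -/
lemma sum_iSup_radSum_le_tsum {T : Type*} {v : T → EuclideanSpace ℝ ι}
    {p : ℕ → T → EuclideanSpace ℝ ι} {A : ℕ → Finset (EuclideanSpace ℝ ι)} {N : ℕ → ℕ}
    {R τ : ℕ → ℝ} (h0 : ∀ t, p 0 t = 0) (hp : ∀ j t, p j t ∈ A j)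
    (hAN : ∀ j, (A j).card ≤ N j) (hN1 : ∀ j, 1 ≤ N j) (hN : Monotone N) (hR : ∀ j, 0 < R j)
    (hlink : ∀ j t, ‖p (j + 1) t - p j t‖ ≤ R j) (hτ : ∀ j t, ‖v t - p (j + 1) t‖ ≤ τ j)
    (hlim : Filter.Tendsto τ Filter.atTop (nhds 0)) [DecidableEq ι] :
    ∑ e : ι → Bool, ⨆ t, ENNReal.ofReal |radSum e (v t)| ≤
      2 ^ Fintype.card ι * ∑' j, ENNReal.ofReal (3 * R j) * sqrtEntropy (N (j + 1)) := by
  classical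
  set K : ℝ≥0∞ := 2 ^ Fintype.card ι with hK
  set S := ∑' j, ENNReal.ofReal (3 * R j) * sqrtEntropy (N (j + 1)) with hS
  have key : ∀ m : ℕ, ∑ e : ι → Bool, ⨆ t, ENNReal.ofReal |radSum e (v t)| ≤
      K * S + K * ENNReal.ofReal (Fintype.card ι * τ m) := by
    intro m
    have hpt : ∀ e : ι → Bool, ⨆ t, ENNReal.ofReal |radSum e (v t)| ≤
        (∑ j ∈ Finset.range (m + 1), ⨆ t, ENNReal.ofReal |radSum e (p (j + 1) t - p j t)|) +
          ENNReal.ofReal (Fintype.card ι * τ m) := by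
      intro e
      refine iSup_le fun t => ?_
      have htel : radSum e (v t) = (∑ j ∈ Finset.range (m + 1), radSum e (p (j + 1) t - p j t)) +
          radSum e (v t - p (m + 1) t) := by
        simp_rw [radSum_sub]
        rw [Finset.sum_range_sub (fun j => radSum e (p j t)), h0, radSum_zero]
        ring
      have habs : |radSum e (v t)| ≤
          (∑ j ∈ Finset.range (m + 1), |radSum e (p (j + 1) t - p j t)|) +
            Fintype.card ι * τ m := by
        rw [htel]
        refine (abs_add_le _ _).trans (add_le_add (Finset.abs_sum_le_sum_abs _ _) ?_)
        refine (abs_radSum_le _ _).trans ?_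
        exact mul_le_mul_of_nonneg_left (hτ m t) (by positivity)
      refine (ENNReal.ofReal_le_ofReal habs).trans (ENNReal.ofReal_add_le.trans ?_)
      gcongr
      rw [ENNReal.ofReal_sum_of_nonneg fun _ _ => abs_nonneg _]
      exact Finset.sum_le_sum fun j _ =>
        le_iSup (fun t => ENNReal.ofReal |radSum e (p (j + 1) t - p j t)|) t
    calc ∑ e : ι → Bool, ⨆ t, ENNReal.ofReal |radSum e (v t)|
        ≤ ∑ e : ι → Bool, ((∑ j ∈ Finset.range (m + 1),
            ⨆ t, ENNReal.ofReal |radSum e (p (j + 1) t - p j t)|) +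
              ENNReal.ofReal (Fintype.card ι * τ m)) := Finset.sum_le_sum fun e _ => hpt e
      _ = (∑ j ∈ Finset.range (m + 1), ∑ e : ι → Bool,
            ⨆ t, ENNReal.ofReal |radSum e (p (j + 1) t - p j t)|) +
              K * ENNReal.ofReal (Fintype.card ι * τ m) := by
          rw [Finset.sum_add_distrib, Finset.sum_comm]
          simp [hK]
      _ ≤ (∑ j ∈ Finset.range (m + 1), K * (ENNReal.ofReal (3 * R j) * sqrtEntropy (N (j + 1)))) +
              K * ENNReal.ofReal (Fintype.card ι * τ m) := by
          gcongr with j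
          refine sum_iSup_radSum_le (hR j)
            (A := (A (j + 1) ×ˢ A j).image fun q => q.1 - q.2) (fun t => ?_) (hlink j)
            (hN1 (j + 1)) ?_
          · exact Finset.mem_image.2 ⟨(p (j + 1) t, p j t),
              Finset.mem_product.2 ⟨hp _ _, hp _ _⟩, rfl⟩
          · refine Finset.card_image_le.trans ?_
            rw [Finset.card_product, sq]
            exact Nat.mul_le_mul (hAN _) ((hAN _).trans (hN (Nat.le_succ j)))
      _ ≤ K * S + K * ENNReal.ofReal (Fintype.card ι * τ m) := by
          rw [← Finset.mul_sum]
          gcongr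
          exact ENNReal.sum_le_tsum _
  have hlim' : Filter.Tendsto (fun m => K * S + K * ENNReal.ofReal (Fintype.card ι * τ m))
      Filter.atTop (nhds (K * S + K * ENNReal.ofReal (Fintype.card ι * 0))) := by
    refine tendsto_const_nhds.add (ENNReal.Tendsto.const_mul ?_ (Or.inr (by simp [hK])))
    exact ENNReal.tendsto_ofReal (hlim.const_mul _)
  have := ge_of_tendsto' hlim' key
  simpa using this

end Maximal

section Antitone

lemma tsum_dyadic_mul_le_lintegral {g : ℝ → ℝ≥0∞} (hg : Antitone g) {δ : ℝ} (hδ : 0 < δ) :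
    ∑' j : ℕ, ENNReal.ofReal (δ * (1 / 2) ^ (j + 1)) * g (δ * (1 / 2) ^ j) ≤
      ∫⁻ ε in Ioo 0 δ, g ε := by
  set u : ℕ → ℝ := fun j => δ * (1 / 2) ^ j with hu
  have hanti : Antitone u := fun i j hij =>
    mul_le_mul_of_nonneg_left (pow_le_pow_of_le_one (by norm_num) (by norm_num) hij) hδ.le
  have hdisj : Pairwise (Function.onFun Disjoint fun j => Ioo (u (j + 1)) (u j)) :=
    hanti.pairwise_disjoint_on_Ioo_succ
  have hsub : (⋃ j, Ioo (u (j + 1)) (u j)) ⊆ Ioo 0 δ := by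
    refine iUnion_subset fun j t ht => ⟨lt_trans (by positivity) ht.1, lt_of_lt_of_le ht.2 ?_⟩
    have := hanti (Nat.zero_le j)
    simpa [hu] using this
  calc ∑' j : ℕ, ENNReal.ofReal (δ * (1 / 2) ^ (j + 1)) * g (δ * (1 / 2) ^ j)
      ≤ ∑' j : ℕ, ∫⁻ ε in Ioo (u (j + 1)) (u j), g ε := by
        refine ENNReal.tsum_le_tsum fun j => ?_
        calc ENNReal.ofReal (δ * (1 / 2) ^ (j + 1)) * g (δ * (1 / 2) ^ j)
            = ∫⁻ _ in Ioo (u (j + 1)) (u j), g (u j) := by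
              rw [setLIntegral_const, Real.volume_Ioo, mul_comm]
              congr 2
              simp only [hu, pow_succ]
              ring
          _ ≤ _ := setLIntegral_mono' measurableSet_Ioo fun t ht => hg ht.2.le
    _ = ∫⁻ ε in ⋃ j, Ioo (u (j + 1)) (u j), g ε :=
        (lintegral_iUnion (fun _ => measurableSet_Ioo) hdisj _).symm
    _ ≤ ∫⁻ ε in Ioo 0 δ, g ε := lintegral_mono_set hsub

end Antitone

section SampleVec

variable {X : Type*} {n : ℕ}

/-- The vector of values of a function along a sample. -/
noncomputable def sampleVec (h : X → ℝ) (x : Fin n → X) : EuclideanSpace ℝ (Fin n) :=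
  WithLp.toLp 2 fun i => h (x i)

lemma norm_sampleVec_sq (h : X → ℝ) (x : Fin n → X) :
    ‖sampleVec h x‖ ^ 2 = ∑ i, h (x i) ^ 2 := by
  rw [EuclideanSpace.real_norm_sq_eq]; rfl

lemma norm_sampleVec_le {h k : X → ℝ} {L : ℝ} (hL : 0 ≤ L) {x : Fin n → X}
    (hhk : ∀ i, |h (x i)| ≤ L * |k (x i)|) : ‖sampleVec h x‖ ≤ L * ‖sampleVec k x‖ := by
  refine le_of_sq_le_sq ?_ (by positivity)
  rw [mul_pow, norm_sampleVec_sq, norm_sampleVec_sq, Finset.mul_sum]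
  refine Finset.sum_le_sum fun i _ => ?_
  rw [← mul_pow, ← sq_abs (h _), ← sq_abs (L * _), abs_mul, abs_of_nonneg hL]
  exact pow_le_pow_left₀ (abs_nonneg _) (hhk i) 2

end SampleVec

section Empirical

variable {X : Type*} [MeasurableSpace X] {n : ℕ}

/-- The empirical measure of a sample. -/
noncomputable def empMeasure (x : Fin n → X) : Measure X :=
  ∑ i, (n : ℝ≥0∞)⁻¹ • Measure.dirac (x i)

lemma isProbabilityMeasure_empMeasure (hn : n ≠ 0) (x : Fin n → X) :
    IsProbabilityMeasure (empMeasure x) := by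
  constructor
  simp only [empMeasure, Measure.coe_finsetSum, Finset.sum_apply, Measure.smul_apply,
    measure_univ, smul_eq_mul, mul_one, Finset.sum_const, Finset.card_univ, Fintype.card_fin,
    nsmul_eq_mul]
  exact ENNReal.mul_inv_cancel (by exact_mod_cast hn) (ENNReal.natCast_ne_top n)

lemma isFinitelyDiscrete_empMeasure (hn : n ≠ 0) (x : Fin n → X) :
    IsFinitelyDiscrete (empMeasure x) := by
  classical
  refine ⟨isProbabilityMeasure_empMeasure hn x, Finset.univ.image x,
    fun y => (Finset.univ.filter fun i => x i = y).card • (n : ℝ≥0∞)⁻¹, ?_⟩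
  rw [empMeasure, Finset.sum_comp (fun y => (n : ℝ≥0∞)⁻¹ • Measure.dirac y) x]
  exact Finset.sum_congr rfl fun y _ => (smul_assoc _ _ _).symm

lemma lintegral_empMeasure (x : Fin n → X) {f : X → ℝ≥0∞} (hf : Measurable f) :
    ∫⁻ y, f y ∂(empMeasure x) = (n : ℝ≥0∞)⁻¹ * ∑ i, f (x i) := by
  rw [empMeasure, lintegral_finsetSum_measure, Finset.mul_sum]
  refine Finset.sum_congr rfl fun i _ => ?_
  rw [lintegral_smul_measure, lintegral_dirac' _ hf, smul_eq_mul]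

lemma eLpNorm_empMeasure (hn : n ≠ 0) (x : Fin n → X) {h : X → ℝ} (hh : Measurable h) :
    eLpNorm h 2 (empMeasure x) = ENNReal.ofReal (‖sampleVec h x‖ / √(n : ℝ)) := by
  have hn' : (0 : ℝ) < n := by exact_mod_cast Nat.pos_of_ne_zero hn
  rw [eLpNorm_eq_lintegral_rpow_enorm_toReal (by norm_num) (by norm_num)]
  have h1 : ∫⁻ y, ‖h y‖ₑ ^ (2 : ℝ≥0∞).toReal ∂(empMeasure x) =
      ENNReal.ofReal ((‖sampleVec h x‖ / √(n : ℝ)) ^ 2) := by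
    rw [lintegral_empMeasure x (by fun_prop), div_pow, norm_sampleVec_sq, Real.sq_sqrt hn'.le,
      div_eq_inv_mul, ENNReal.ofReal_mul (by positivity), ENNReal.ofReal_inv_of_pos hn',
      ENNReal.ofReal_natCast, ENNReal.ofReal_sum_of_nonneg fun _ _ => by positivity]
    congr 1
    refine Finset.sum_congr rfl fun i _ => ?_
    rw [← sq_abs, ENNReal.ofReal_pow (abs_nonneg _), Real.enorm_eq_ofReal_abs]
    norm_num
  rw [h1, ENNReal.ofReal_pow (by positivity), ← ENNReal.rpow_natCast, ← ENNReal.rpow_mul]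
  norm_num

lemma exists_finset_sampleVec_cover (hn : n ≠ 0) {x : Fin n → X} {𝓕 : Set (X → ℝ)}
    (hm : ∀ f ∈ 𝓕, Measurable f) (hb : ∀ f ∈ 𝓕, ∀ x, |f x| ≤ 1) {φ : ℝ → ℝ} {L : ℝ} (hL : 0 ≤ L)
    (hφ : ∀ a b, |φ a - φ b| ≤ L * |a - b|) {r : ℝ≥0}
    (hr : coveringL2 (empMeasure x) 𝓕 r ≠ ⊤) :
    ∃ A : Finset (EuclideanSpace ℝ (Fin n)), A.card ≤ (coveringL2 (empMeasure x) 𝓕 r).toNat ∧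
      ∀ f ∈ 𝓕, ∃ a ∈ A, ‖sampleVec (fun y => φ (f y)) x - a‖ ≤ L * (√(n : ℝ) * r) := by
  classical
  have hn' : (0 : ℝ) < √(n : ℝ) := Real.sqrt_pos.2 (by exact_mod_cast Nat.pos_of_ne_zero hn)
  have := isProbabilityMeasure_empMeasure hn x
  obtain ⟨C, hC, hCcard⟩ : ∃ C : Set (Lp ℝ 2 (empMeasure x)),
      Metric.IsCover r {u : Lp ℝ 2 (empMeasure x) | ∃ f ∈ 𝓕, u =ᵐ[empMeasure x] f} C ∧
        C.encard = coveringL2 (empMeasure x) 𝓕 r := by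
    have hne : Nonempty {C : Set (Lp ℝ 2 (empMeasure x)) //
        Metric.IsCover r {u : Lp ℝ 2 (empMeasure x) | ∃ f ∈ 𝓕, u =ᵐ[empMeasure x] f} C} :=
      ⟨⟨_, Metric.IsCover.rfl⟩⟩
    have h := ENat.exists_eq_iInf (fun C : {C : Set (Lp ℝ 2 (empMeasure x)) //
        Metric.IsCover r {u : Lp ℝ 2 (empMeasure x) | ∃ f ∈ 𝓕, u =ᵐ[empMeasure x] f} C} =>
          (C : Set (Lp ℝ 2 (empMeasure x))).encard)
    obtain ⟨⟨C, hC⟩, h⟩ := h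
    refine ⟨C, hC, ?_⟩
    rw [h, iInf_subtype]
    rfl
  have hfin : C.Finite := by
    rw [← Set.encard_ne_top_iff, hCcard]; exact hr
  refine ⟨hfin.toFinset.image fun c => sampleVec (fun y => φ (c y)) x, ?_, fun f hf => ?_⟩
  · refine Finset.card_image_le.trans (le_of_eq ?_)
    rw [← hCcard, hfin.encard_eq_coe_toFinset_card, ENat.toNat_natCast]
  · have hmem : MemLp f 2 (empMeasure x) :=
      MemLp.of_bound (hm f hf).aestronglyMeasurable 1 (Filter.Eventually.of_forall (hb f hf))
    obtain ⟨c, hcC, hc⟩ := hC (show hmem.toLp f ∈ _ from ⟨f, hf, hmem.coeFn_toLp⟩)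
    refine ⟨sampleVec (fun y => φ (c y)) x, Finset.mem_image_of_mem _ (by simpa using hcC), ?_⟩
    have hcm : Measurable c := (Lp.stronglyMeasurable c).measurable
    have hc' : eLpNorm (fun y => f y - c y) 2 (empMeasure x) ≤ r := by
      have : edist (hmem.toLp f) c ≤ r := hc
      rw [Lp.edist_def] at this
      refine le_trans (le_of_eq (eLpNorm_congr_ae ?_)) this
      filter_upwards [hmem.coeFn_toLp] with y hy
      simp [hy]
    rw [eLpNorm_empMeasure (h := fun y => f y - c y) hn x ((hm f hf).sub hcm), ENNReal.ofReal_le_coe,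
      div_le_iff₀ hn'] at hc'
    have h1 : sampleVec (fun y => φ (f y)) x - sampleVec (fun y => φ (c y)) x =
        sampleVec (fun y => φ (f y) - φ (c y)) x := rfl
    rw [h1]
    refine (norm_sampleVec_le (k := fun y => f y - c y) hL fun i => hφ _ _).trans ?_
    rw [mul_comm (√(n : ℝ))]
    exact mul_le_mul_of_nonneg_left hc' hL

/-- Uniform entropy bound for the Rademacher averages, given the sample, of a Lipschitz
transformation of a class. -/
lemma sum_iSup_radSum_comp_le (hn : n ≠ 0) (x : Fin n → X) {𝓕 : Set (X → ℝ)} (hne : 𝓕.Nonempty)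
    (hm : ∀ f ∈ 𝓕, Measurable f) {Fenv : X → ℝ} (henv : IsEnvelope 𝓕 Fenv)
    (hF1 : ∀ y, Fenv y ≤ 1) {φ : ℝ → ℝ} {L : ℝ} (hL : 0 < L)
    (hφ : ∀ a b, |φ a - φ b| ≤ L * |a - b|) (hφ0 : φ 0 = 0) {δ : ℝ} (hδ : 0 < δ) {σ : ℝ}
    (hσ : ∀ f ∈ 𝓕, ‖sampleVec f x‖ ≤ √(n : ℝ) * σ) :
    ∑ e : Fin n → Bool, ⨆ f ∈ 𝓕, ENNReal.ofReal |∑ i, rad (e i) * φ (f (x i))| ≤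
      2 ^ n * (ENNReal.ofReal (18 * L * √(n : ℝ) * (σ / δ + ‖sampleVec Fenv x‖ / √(n : ℝ))) *
        uniformEntropyIntegral δ 𝓕 Fenv) := by
  have hn' : (0 : ℝ) < √(n : ℝ) := Real.sqrt_pos.2 (by exact_mod_cast Nat.pos_of_ne_zero hn)
  set B := ‖sampleVec Fenv x‖ / √(n : ℝ) with hB
  have hb : ∀ f ∈ 𝓕, ∀ y, |f y| ≤ 1 := fun f hf y => (henv.2 f hf y).trans (hF1 y)
  have hσ0 : 0 ≤ σ := by
    obtain ⟨f, hf⟩ := hne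
    exact nonneg_of_mul_nonneg_right ((norm_nonneg _).trans (hσ f hf)) hn'
  have hB0 : 0 ≤ B := by positivity
  rcases hB0.eq_or_lt with hBz | hBpos
  · have hv : ‖sampleVec Fenv x‖ = 0 := by
      rcases div_eq_zero_iff.1 (hB ▸ hBz.symm) with h | h
      · exact h
      · exact absurd h hn'.ne'
    have hsum := norm_sampleVec_sq Fenv x
    rw [hv, zero_pow two_ne_zero] at hsum
    have hz : ∀ f ∈ 𝓕, ∀ i, f (x i) = 0 := by
      intro f hf i
      have h1 := (Finset.sum_eq_zero_iff_of_nonneg fun i _ => sq_nonneg (Fenv (x i))).1 hsum.symm i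
        (Finset.mem_univ i)
      have h2 : Fenv (x i) = 0 := pow_eq_zero_iff two_ne_zero |>.1 h1
      exact abs_nonpos_iff.1 (h2 ▸ henv.2 f hf (x i))
    refine le_trans (le_of_eq (Finset.sum_eq_zero fun e _ => ?_)) zero_le
    refine iSup₂_eq_bot.2 fun f hf => ?_
    simp [hz f hf, hφ0]
  set g : ℝ → ℝ≥0∞ := fun ε => sqrtEntropy (coveringL2 (empMeasure x) 𝓕
    (ε.toNNReal * (eLpNorm Fenv 2 (empMeasure x)).toNNReal)) with hg
  set J := uniformEntropyIntegral δ 𝓕 Fenv with hJ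
  have hgJ : ∫⁻ ε in Ioo 0 δ, g ε ≤ J :=
    le_iSup₂ (f := fun (Q : Measure X) (_ : IsFinitelyDiscrete Q) => ∫⁻ ε in Ioo (0 : ℝ) δ,
      sqrtEntropy (coveringL2 Q 𝓕 (ε.toNNReal * (eLpNorm Fenv 2 Q).toNNReal)))
      (empMeasure x) (isFinitelyDiscrete_empMeasure hn x)
  have hcov : ∀ s t : ℝ, s ≤ t →
      coveringL2 (empMeasure x) 𝓕 (t.toNNReal * (eLpNorm Fenv 2 (empMeasure x)).toNNReal) ≤
      coveringL2 (empMeasure x) 𝓕 (s.toNNReal * (eLpNorm Fenv 2 (empMeasure x)).toNNReal) :=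
    fun s t hst => Metric.externalCoveringNumber_anti
      (mul_le_mul_left (Real.toNNReal_le_toNNReal hst) _)
  have hganti : Antitone g := fun s t hst => sqrtEntropy_mono (hcov s t hst)
  have hdy := (tsum_dyadic_mul_le_lintegral hganti hδ).trans hgJ
  by_cases hJtop : J = ⊤
  · rw [hJtop, ENNReal.mul_top (by simpa using by positivity), ENNReal.mul_top (by simp)]
    exact le_top
  set u : ℕ → ℝ := fun j => δ * (1 / 2) ^ j with hu
  set c : ℕ → ℕ∞ := fun j => coveringL2 (empMeasure x) 𝓕
    ((u j).toNNReal * (eLpNorm Fenv 2 (empMeasure x)).toNNReal) with hc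
  have hupos : ∀ j, 0 < u j := fun j => by positivity
  have husucc : ∀ j, u j = 2 * u (j + 1) := fun j => by simp only [hu, pow_succ]; ring
  have huanti : Antitone u := fun i j hij =>
    mul_le_mul_of_nonneg_left (pow_le_pow_of_le_one (by norm_num) (by norm_num) hij) hδ.le
  have hcfin : ∀ j, c j ≠ ⊤ := by
    intro j hj
    have h1 := (ENNReal.le_tsum (f := fun j => ENNReal.ofReal (u (j + 1)) * g (u j)) j).trans hdy
    have h2 : g (u j) = ⊤ := by
      have : g (u j) = sqrtEntropy (c j) := rfl
      rw [this, hj, sqrtEntropy_top]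
    rw [h2, ENNReal.mul_top (by simpa using hupos (j + 1))] at h1
    exact hJtop (top_le_iff.1 h1)
  set N : ℕ → ℕ := fun j => (c j).toNat with hN
  have hNc : ∀ j, ((N j : ℕ) : ℕ∞) = c j := fun j => ENat.natCast_toNat (hcfin j)
  have hNmono : Monotone N := fun i j hij =>
    ENat.toNat_le_toNat (hcov _ _ (huanti hij)) (hcfin j)
  have := isProbabilityMeasure_empMeasure hn x
  have hN1 : ∀ j, 1 ≤ N j := by
    intro j
    have : 0 < c j := by
      refine Metric.externalCoveringNumber_pos_iff.2 ?_
      obtain ⟨f, hf⟩ := hne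
      have hmem : MemLp f 2 (empMeasure x) :=
        MemLp.of_bound (hm f hf).aestronglyMeasurable 1 (Filter.Eventually.of_forall (hb f hf))
      exact ⟨hmem.toLp f, f, hf, hmem.coeFn_toLp⟩
    rw [← hNc j] at this
    exact_mod_cast this
  have hrad : ∀ j, (((u j).toNNReal * (eLpNorm Fenv 2 (empMeasure x)).toNNReal : ℝ≥0) : ℝ) =
      u j * B := by
    intro j
    rw [eLpNorm_empMeasure hn x henv.1, NNReal.coe_mul, Real.coe_toNNReal _ (hupos j).le]
    congr 1
    exact ENNReal.toReal_ofReal hB0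
  choose A hAcard hA using fun j => exists_finset_sampleVec_cover hn hm hb hL.le hφ (hcfin j)
  choose! a ha hadist using hA
  have key := sum_iSup_radSum_le_tsum (T := 𝓕) (v := fun f => sampleVec (fun y => φ (f.1 y)) x)
    (p := fun j f => if j = 0 then 0 else a j f.1)
    (A := fun j => if j = 0 then {0} else A j) (N := N)
    (R := fun j => 3 * L * √(n : ℝ) * (σ / δ + B) * u (j + 1))
    (τ := fun j => L * (√(n : ℝ) * (u (j + 1) * B)))
    (fun _ => by simp)
    (fun j f => by
      by_cases hj : j = 0
      · simp [hj]
      · simp only [hj, if_false]; exact ha j f.1 f.2)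
    (fun j => by
      by_cases hj : j = 0
      · simpa [hj] using hN1 0
      · simp only [hj, if_false]; exact hAcard j)
    hN1 hNmono
    (fun j => by have := hupos (j + 1); positivity)
    (fun j f => by
      have h1 := hadist (j + 1) f.1 f.2
      rw [hrad] at h1
      have hpos := hupos (j + 1)
      simp only [Nat.add_eq_zero_iff, one_ne_zero, and_false, if_false]
      rcases Nat.eq_zero_or_pos j with rfl | hj
      · simp only [if_true, sub_zero]
        rw [zero_add] at h1 hpos ⊢
        have h2 : ‖sampleVec (fun y => φ (f.1 y)) x‖ ≤ L * (√(n : ℝ) * σ) := by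
          refine (norm_sampleVec_le (k := f.1) hL.le fun i => ?_).trans
            (mul_le_mul_of_nonneg_left (hσ f.1 f.2) hL.le)
          simpa [hφ0] using hφ (f.1 (x i)) 0
        have h3 := norm_sub_le (sampleVec (fun y => φ (f.1 y)) x)
          (sampleVec (fun y => φ (f.1 y)) x - a 1 f.1)
        rw [sub_sub_cancel] at h3
        have h4 : σ = 2 * (σ / δ * u 1) := by
          simp only [hu]; field_simp
        have h5 : 0 ≤ σ / δ * u 1 := by positivity
        have h6 : 0 ≤ L * √(n : ℝ) * (σ / δ * u 1) := by positivity
        have h7 : 0 ≤ L * √(n : ℝ) * (B * u 1) := by positivity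
        have h8 : L * (√(n : ℝ) * σ) = 2 * (L * √(n : ℝ) * (σ / δ * u 1)) := by
          calc L * (√(n : ℝ) * σ) = L * (√(n : ℝ) * (2 * (σ / δ * u 1))) := by rw [← h4]
            _ = _ := by ring
        nlinarith
      · simp only [hj.ne', if_false]
        have h2 := hadist j f.1 f.2
        rw [hrad, husucc j] at h2
        have h3 := norm_sub_le (sampleVec (fun y => φ (f.1 y)) x - a j f.1)
          (sampleVec (fun y => φ (f.1 y)) x - a (j + 1) f.1)
        rw [sub_sub_sub_cancel_left] at h3
        have h6 : 0 ≤ L * √(n : ℝ) * (σ / δ * u (j + 1)) := by positivity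
        nlinarith)
    (fun j f => by
      have h1 := hadist (j + 1) f.1 f.2
      rw [hrad] at h1
      simpa using h1)
    (by
      have h1 : Filter.Tendsto u Filter.atTop (nhds (δ * 0)) :=
        (tendsto_pow_atTop_nhds_zero_of_lt_one (by norm_num) (by norm_num)).const_mul δ
      have h2 := ((h1.comp (Filter.tendsto_add_atTop_nat 1)).mul_const B).const_mul (√(n : ℝ))
      simpa using h2.const_mul L)
  rw [Fintype.card_fin] at key
  have hlhs : ∀ e : Fin n → Bool, ⨆ f ∈ 𝓕, ENNReal.ofReal |∑ i, rad (e i) * φ (f (x i))| =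
      ⨆ f : 𝓕, ENNReal.ofReal |radSum e (sampleVec (fun y => φ (f.1 y)) x)| := by
    intro e
    rw [iSup_subtype']
    rfl
  simp_rw [hlhs]
  refine key.trans ?_
  gcongr
  calc ∑' j, ENNReal.ofReal (3 * (3 * L * √(n : ℝ) * (σ / δ + B) * u (j + 1))) *
        sqrtEntropy (N (j + 1))
      = ∑' j, ENNReal.ofReal (18 * L * √(n : ℝ) * (σ / δ + B)) *
          (ENNReal.ofReal (u (j + 1 + 1)) * g (u (j + 1))) := by
        refine tsum_congr fun j => ?_
        have h1 : 3 * (3 * L * √(n : ℝ) * (σ / δ + B) * u (j + 1)) =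
            18 * L * √(n : ℝ) * (σ / δ + B) * u (j + 1 + 1) := by
          rw [husucc (j + 1)]; ring
        rw [hNc, ← mul_assoc (ENNReal.ofReal _) (ENNReal.ofReal _),
          ← ENNReal.ofReal_mul (by positivity), h1]
    _ = ENNReal.ofReal (18 * L * √(n : ℝ) * (σ / δ + B)) *
          ∑' j, ENNReal.ofReal (u (j + 1 + 1)) * g (u (j + 1)) := ENNReal.tsum_mul_left
    _ ≤ ENNReal.ofReal (18 * L * √(n : ℝ) * (σ / δ + B)) * J := by
        gcongr
        exact (ENNReal.tsum_comp_le_tsum_of_injective (add_left_injective 1)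
          fun j => ENNReal.ofReal (u (j + 1)) * g (u j)).trans hdy

end Empirical

section RealInequalities

lemma abs_clip_sq_sub_le (a b : ℝ) :
    |(max (-1) (min a 1)) ^ 2 - (max (-1) (min b 1)) ^ 2| ≤ 2 * |a - b| := by
  set u := max (-1) (min a 1) with hu
  set v := max (-1) (min b 1) with hv
  have h1 : |u - v| ≤ |a - b| := by
    rw [hu, hv, max_comm, max_comm (-1)]
    exact (abs_max_sub_max_le_abs _ _ _).trans (abs_inf_sub_inf_le_abs _ _ _)
  have h2 : |u + v| ≤ 2 := by
    have hu1 : -1 ≤ u := le_max_left _ _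
    have hv1 : -1 ≤ v := le_max_left _ _
    have hu2 : u ≤ 1 := max_le (by norm_num) (min_le_right _ _)
    have hv2 : v ≤ 1 := max_le (by norm_num) (min_le_right _ _)
    rw [abs_le]; constructor <;> linarith
  rw [sq_sub_sq, abs_mul]
  exact mul_le_mul h2 h1 (abs_nonneg _) (by norm_num)

lemma clip_eq_self {t : ℝ} (ht : |t| ≤ 1) : max (-1) (min t 1) = t := by
  rw [min_eq_left (abs_le.1 ht).2, max_eq_right (abs_le.1 ht).1]

lemma add_le_of_sq_le {A Z δ j s : ℝ} (hA : 0 < A) (hδ : 0 < δ) (hs : 0 < s) (hj : 0 ≤ j)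
    (hZ0 : 0 ≤ Z) (hZ : Z ^ 2 ≤ δ ^ 2 * A ^ 2 + 1 / s * (72 * (Z / δ + A) * j)) :
    36 * (Z / δ + A) * j ≤ 5184 * (j * (1 + j / (δ ^ 2 * s * A)) * A) := by
  obtain ⟨w, hw⟩ : ∃ w, w = Z / (δ * A) := ⟨_, rfl⟩
  obtain ⟨b, hb⟩ : ∃ b, b = j / (δ ^ 2 * s * A) := ⟨_, rfl⟩
  have hb0 : 0 ≤ b := by rw [hb]; positivity
  have hw0 : 0 ≤ w := by rw [hw]; positivity
  have hZw : Z = δ * A * w := by rw [hw]; field_simp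
  have hjb : j = b * (δ ^ 2 * s * A) := by rw [hb]; field_simp
  have hZd : Z / δ = A * w := by rw [hZw]; field_simp
  have hquad : w ^ 2 ≤ 1 + 72 * b * (w + 1) := by
    have h1 : (δ ^ 2 * A ^ 2) * w ^ 2 ≤ (δ ^ 2 * A ^ 2) * (1 + 72 * b * (w + 1)) := by
      have h2 : 1 / s * (72 * (Z / δ + A) * j) = (δ ^ 2 * A ^ 2) * (72 * b * (w + 1)) := by
        rw [hZd, hjb]; field_simp
      rw [h2, hZw] at hZ
      linarith
    exact le_of_mul_le_mul_left h1 (by positivity)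
  have hw1 : w ≤ 1 + 144 * b := by
    by_contra! hlt
    nlinarith [mul_nonneg hb0 hw0, mul_pos (sub_pos.2 hlt) (sub_pos.2 hlt)]
  rw [← hb, hZd]
  have hAj : 0 ≤ A * j := by positivity
  calc 36 * (A * w + A) * j = A * j * (36 * (w + 1)) := by ring
    _ ≤ A * j * (5184 * (1 + b)) := mul_le_mul_of_nonneg_left (by linarith) hAj
    _ = _ := by ring

end RealInequalities

section SupEmpSq

variable {X : Type*}

/-- The squared uniform empirical `L₂` norm `sup_{f ∈ 𝓕} Pₙ f²`. -/
noncomputable def supEmpSq {n : ℕ} (𝓕 : Set (X → ℝ)) (x : Fin n → X) : ℝ :=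
  (signSup (sqClass 𝓕) (fun _ => 1) x).toReal / n

lemma signSup_sqClass {ι : Type*} [Fintype ι] (𝓕 : Set (X → ℝ)) (e : ι → ℝ) (x : ι → X) :
    signSup (sqClass 𝓕) e x = ⨆ f ∈ 𝓕, ENNReal.ofReal |∑ i, e i * f (x i) ^ 2| := by
  apply le_antisymm
  · refine iSup₂_le ?_
    rintro g ⟨f, hf, rfl⟩
    exact le_iSup₂ (f := fun f (_ : f ∈ 𝓕) => ENNReal.ofReal |∑ i, e i * f (x i) ^ 2|) f hf
  · exact iSup₂_le fun f hf => le_iSup₂ (f := fun g (_ : g ∈ sqClass 𝓕) =>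
      ENNReal.ofReal |∑ i, e i * g (x i)|) (fun y => f y ^ 2) ⟨f, hf, rfl⟩

lemma supEmpSq_nonneg {n : ℕ} (𝓕 : Set (X → ℝ)) (x : Fin n → X) : 0 ≤ supEmpSq 𝓕 x := by
  unfold supEmpSq; positivity

lemma signSup_sqClass_one_le {n : ℕ} {𝓕 : Set (X → ℝ)} (hb : ∀ f ∈ 𝓕, ∀ y, |f y| ≤ 1)
    (x : Fin n → X) : signSup (sqClass 𝓕) (fun _ => 1) x ≤ n := by
  rw [signSup_sqClass]
  refine iSup₂_le fun f hf => ?_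
  rw [← ENNReal.ofReal_natCast]
  refine ENNReal.ofReal_le_ofReal ?_
  simp only [one_mul]
  rw [abs_of_nonneg (Finset.sum_nonneg fun _ _ => sq_nonneg _)]
  calc ∑ i, f (x i) ^ 2 ≤ ∑ _i : Fin n, (1 : ℝ) :=
        Finset.sum_le_sum fun i _ => (sq_le_one_iff_abs_le_one _).2 (hb f hf _)
    _ = n := by simp

lemma supEmpSq_le_one {n : ℕ} {𝓕 : Set (X → ℝ)} (hb : ∀ f ∈ 𝓕, ∀ y, |f y| ≤ 1)
    (x : Fin n → X) : supEmpSq 𝓕 x ≤ 1 := by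
  refine div_le_one_of_le₀ ?_ (by positivity)
  exact ENNReal.toReal_le_of_le_ofReal (by positivity)
    (by rw [ENNReal.ofReal_natCast]; exact signSup_sqClass_one_le hb x)

lemma norm_sampleVec_le_supEmpSq {n : ℕ} (hn : n ≠ 0) {𝓕 : Set (X → ℝ)}
    (hb : ∀ f ∈ 𝓕, ∀ y, |f y| ≤ 1) (x : Fin n → X) {f : X → ℝ} (hf : f ∈ 𝓕) :
    ‖sampleVec f x‖ ≤ √(n : ℝ) * √(supEmpSq 𝓕 x) := by
  have hn' : (0 : ℝ) < n := by exact_mod_cast Nat.pos_of_ne_zero hn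
  rw [← Real.sqrt_mul hn'.le, supEmpSq, mul_div_cancel₀ _ hn'.ne']
  refine Real.le_sqrt_of_sq_le ?_
  rw [norm_sampleVec_sq]
  have h : ENNReal.ofReal |∑ i, (1 : ℝ) * f (x i) ^ 2| ≤
      signSup (sqClass 𝓕) (fun _ => 1) x := by
    rw [signSup_sqClass]
    exact le_iSup₂ (f := fun f (_ : f ∈ 𝓕) => ENNReal.ofReal |∑ i, (1 : ℝ) * f (x i) ^ 2|) f hf
  have hfin : signSup (sqClass 𝓕) (fun _ => 1) x ≠ ⊤ :=
    ne_top_of_le_ne_top (ENNReal.natCast_ne_top n) (signSup_sqClass_one_le hb x)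
  have h2 := (ENNReal.ofReal_le_iff_le_toReal hfin).1 h
  simp only [one_mul] at h2
  exact (le_abs_self _).trans h2

end SupEmpSq

section Bounds

variable {X : Type*} [MeasurableSpace X]

lemma lintegral_le_add_mul_outerExpectation {Ω : Type*} [MeasurableSpace Ω] {μ : Measure Ω}
    [IsProbabilityMeasure μ] {T Z : Ω → ℝ≥0∞} {a b : ℝ≥0∞} (hb0 : b ≠ 0) (hb : b ≠ ⊤)
    (h : ∀ ω, T ω ≤ a + b * Z ω) : ∫⁻ ω, T ω ∂μ ≤ a + b * outerExpectation μ Z := by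
  rw [← tsub_le_iff_left, mul_comm, ← ENNReal.div_le_iff hb0 hb]
  refine le_iInf₂ fun U hU => le_iInf fun hZ => ?_
  rw [ENNReal.div_le_iff hb0 hb, tsub_le_iff_left, mul_comm]
  calc ∫⁻ ω, T ω ∂μ ≤ ∫⁻ ω, (a + b * U ω) ∂μ :=
        lintegral_mono fun ω => (h ω).trans (by gcongr; exact hZ ω)
    _ = a + b * ∫⁻ ω, U ω ∂μ := by
        rw [lintegral_add_left measurable_const, lintegral_const_mul _ hU]
        simp

lemma lintegral_ofReal_sqrt_le {Ω : Type*} [MeasurableSpace Ω] {μ : Measure Ω}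
    [IsProbabilityMeasure μ] {T : Ω → ℝ} (hT : AEMeasurable T μ) (h0 : ∀ ω, 0 ≤ T ω)
    (h1 : ∀ ω, T ω ≤ 1) :
    ∫⁻ ω, ENNReal.ofReal √(T ω) ∂μ ≤ ENNReal.ofReal √(∫ ω, T ω ∂μ) := by
  have hi : Integrable T μ := Integrable.of_bound hT.aestronglyMeasurable 1
    (Filter.Eventually.of_forall fun ω => by
      rw [Real.norm_of_nonneg (h0 ω)]; exact h1 ω)
  have hi' : Integrable (fun ω => √(T ω)) μ :=
    Integrable.of_bound hT.sqrt.aestronglyMeasurable 1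
      (Filter.Eventually.of_forall fun ω => by
        rw [Real.norm_of_nonneg (Real.sqrt_nonneg _)]
        exact Real.sqrt_le_one.2 (h1 ω))
  rw [← ofReal_integral_eq_lintegral_ofReal hi'
    (Filter.Eventually.of_forall fun ω => Real.sqrt_nonneg _)]
  exact ENNReal.ofReal_le_ofReal (Real.strictConcaveOn_sqrt.concaveOn.le_map_integral
    Real.continuous_sqrt.continuousOn isClosed_Ici (Filter.Eventually.of_forall h0) hi hi')

lemma ofReal_supEmpSq_le {P : Measure X} {n : ℕ} (hn : n ≠ 0) {𝓕 : Set (X → ℝ)}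
    (hb : ∀ f ∈ 𝓕, ∀ y, |f y| ≤ 1) {a : ℝ} (ha : ∀ f ∈ 𝓕, ∫ y, f y ^ 2 ∂P ≤ a)
    (x : Fin n → X) :
    ENNReal.ofReal (supEmpSq 𝓕 x) ≤
      ENNReal.ofReal a + ENNReal.ofReal (1 / √(n : ℝ)) * empiricalSup P n (sqClass 𝓕) x := by
  have hn' : (0 : ℝ) < n := by exact_mod_cast Nat.pos_of_ne_zero hn
  have hsn : (0 : ℝ) < √(n : ℝ) := Real.sqrt_pos.2 hn'
  have hfin : signSup (sqClass 𝓕) (fun _ => 1) x ≠ ⊤ :=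
    ne_top_of_le_ne_top (ENNReal.natCast_ne_top n) (signSup_sqClass_one_le hb x)
  rw [supEmpSq, ENNReal.ofReal_div_of_pos hn', ENNReal.ofReal_toReal hfin, signSup_sqClass,
    ENNReal.div_le_iff (by simpa using hn) ENNReal.ofReal_ne_top]
  refine iSup₂_le fun f hf => ?_
  have h1 : ENNReal.ofReal |empProc P n (fun y => f y ^ 2) x| ≤
      empiricalSup P n (sqClass 𝓕) x :=
    le_iSup₂ (f := fun g (_ : g ∈ sqClass 𝓕) => ENNReal.ofReal |empProc P n g x|)
      (fun y => f y ^ 2) ⟨f, hf, rfl⟩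
  have h2 : ENNReal.ofReal a + ENNReal.ofReal (1 / √(n : ℝ)) *
      ENNReal.ofReal |empProc P n (fun y => f y ^ 2) x| ≤
      ENNReal.ofReal a + ENNReal.ofReal (1 / √(n : ℝ)) * empiricalSup P n (sqClass 𝓕) x := by
    gcongr
  refine le_trans ?_ (mul_le_mul_left h2 _)
  have ha0 : 0 ≤ a := (integral_nonneg fun y => sq_nonneg (f y)).trans (ha f hf)
  rw [← ENNReal.ofReal_mul (by positivity), ← ENNReal.ofReal_add ha0 (by positivity),
    ← ENNReal.ofReal_mul (by positivity)]
  refine ENNReal.ofReal_le_ofReal ?_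
  simp only [one_mul]
  rw [abs_of_nonneg (Finset.sum_nonneg fun _ _ => sq_nonneg _)]
  have h3 : ∑ i, f (x i) ^ 2 = n * ∫ y, f y ^ 2 ∂P +
      √(n : ℝ) * empProc P n (fun y => f y ^ 2) x := by
    rw [empProc, ← mul_assoc, mul_one_div_cancel hsn.ne', Finset.sum_sub_distrib]
    simp
  have h4 : 1 / √(n : ℝ) * n = √(n : ℝ) := by
    rw [one_div_mul_eq_div, Real.div_sqrt]
  have h5 : (a + 1 / √(n : ℝ) * |empProc P n (fun y => f y ^ 2) x|) * n =
      n * a + (1 / √(n : ℝ) * n) * |empProc P n (fun y => f y ^ 2) x| := by ring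
  rw [h3, h5, h4]
  have := ha f hf
  gcongr
  exact le_abs_self _

variable {P : Measure X} [IsProbabilityMeasure P]

lemma aemeasurable_supEmpSq {n : ℕ} {𝓕 : Set (X → ℝ)} (h : PMeasurable P (sqClass 𝓕)) :
    AEMeasurable (supEmpSq 𝓕) (Measure.pi fun _ : Fin n => P) :=
  (h.aemeasurable_signSup fun _ => Or.inr rfl).ennreal_toReal.div_const _

lemma integral_sampleVec_sq {n : ℕ} (hn : n ≠ 0) {F : X → ℝ} (hF : Measurable F)
    (hF1 : ∀ y, |F y| ≤ 1) :
    ∫ x, (‖sampleVec F x‖ ^ 2 / n) ∂(Measure.pi fun _ : Fin n => P) = ∫ y, F y ^ 2 ∂P := by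
  have hn' : (n : ℝ) ≠ 0 := by exact_mod_cast hn
  have hi : Integrable (fun y => F y ^ 2) P :=
    Integrable.of_bound (hF.pow_const 2).aestronglyMeasurable 1
      (Filter.Eventually.of_forall fun y => by
        rw [Real.norm_of_nonneg (sq_nonneg _)]
        exact (sq_le_one_iff_abs_le_one _).2 (hF1 y))
  simp_rw [norm_sampleVec_sq]
  rw [integral_div, integral_finsetSum Finset.univ (f := fun i (x : Fin n → X) => F (x i) ^ 2)
    fun i _ => (measurePreserving_eval (fun _ : Fin n => P) i).integrable_comp_of_integrable hi]
  have h : ∀ i, ∫ x, F (x i) ^ 2 ∂(Measure.pi fun _ : Fin n => P) = ∫ y, F y ^ 2 ∂P := by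
    intro i
    conv_rhs => rw [← (measurePreserving_eval (fun _ : Fin n => P) i).map_eq]
    rw [integral_map (measurable_pi_apply i).aemeasurable (hF.pow_const 2).aestronglyMeasurable]
  simp_rw [h]
  simp [hn']

/-- Entropy bound for the outer expectation of the empirical process, in terms of the mean of
`sup_{f ∈ 𝓕} Pₙ f²`, for a Lipschitz transformation of the class. -/
lemma outerExpectation_empiricalSup_comp_le {𝓕 𝓖 : Set (X → ℝ)} (hne : 𝓕.Nonempty)
    (hm : ∀ f ∈ 𝓕, Measurable f) (hsq : PMeasurable P (sqClass 𝓕)) {Fenv : X → ℝ}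
    (henv : IsEnvelope 𝓕 Fenv) (hF1 : ∀ y, Fenv y ≤ 1) {φ : ℝ → ℝ} {L : ℝ} (hL : 0 < L)
    (hφ : ∀ a b, |φ a - φ b| ≤ L * |a - b|) (hφ0 : φ 0 = 0)
    (hGm : ∀ g ∈ 𝓖, Measurable g) (hGb : ∀ g ∈ 𝓖, ∀ y, |g y| ≤ 1) (hGP : PMeasurable P 𝓖)
    {n : ℕ} (hn : n ≠ 0)
    (hG : ∀ (e : Fin n → ℝ) (x : Fin n → X),
      signSup 𝓖 e x ≤ ⨆ f ∈ 𝓕, ENNReal.ofReal |∑ i, e i * φ (f (x i))|)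
    {δ : ℝ} (hδ : 0 < δ) :
    outerExpectation (Measure.pi fun _ : Fin n => P) (empiricalSup P n 𝓖) ≤
      ENNReal.ofReal (36 * L *
        (√(∫ x, supEmpSq 𝓕 x ∂(Measure.pi fun _ : Fin n => P)) / δ + √(∫ y, Fenv y ^ 2 ∂P))) *
      uniformEntropyIntegral δ 𝓕 Fenv := by
  set μ := Measure.pi fun _ : Fin n => P with hμ
  set J := uniformEntropyIntegral δ 𝓕 Fenv with hJ
  have hn' : (0 : ℝ) < n := by exact_mod_cast Nat.pos_of_ne_zero hn
  have hsn : (0 : ℝ) < √(n : ℝ) := Real.sqrt_pos.2 hn'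
  have hb : ∀ f ∈ 𝓕, ∀ y, |f y| ≤ 1 := fun f hf y => (henv.2 f hf y).trans (hF1 y)
  have hFabs : ∀ y, |Fenv y| ≤ 1 := fun y => by
    obtain ⟨f, hf⟩ := hne
    rw [abs_of_nonneg ((abs_nonneg _).trans (henv.2 f hf y))]
    exact hF1 y
  have hTB0 : ∀ x : Fin n → X, √(‖sampleVec Fenv x‖ ^ 2 / n) = ‖sampleVec Fenv x‖ / √(n : ℝ) :=
    fun x => by rw [Real.sqrt_div (by positivity), Real.sqrt_sq (norm_nonneg _)]
  have hTBm : Measurable fun x : Fin n → X => ‖sampleVec Fenv x‖ ^ 2 / (n : ℝ) := by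
    simp_rw [norm_sampleVec_sq]
    exact (Finset.measurable_sum _ fun i _ =>
      (henv.1.comp (measurable_pi_apply i)).pow_const 2).div_const _
  have hTB1 : ∀ x : Fin n → X, ‖sampleVec Fenv x‖ ^ 2 / (n : ℝ) ≤ 1 := by
    intro x
    refine div_le_one_of_le₀ ?_ hn'.le
    rw [norm_sampleVec_sq]
    calc ∑ i, Fenv (x i) ^ 2 ≤ ∑ _i : Fin n, (1 : ℝ) :=
          Finset.sum_le_sum fun i _ => (sq_le_one_iff_abs_le_one _).2 (hFabs _)
      _ = n := by simp
  have hσm : AEMeasurable (supEmpSq 𝓕) μ := aemeasurable_supEmpSq hsq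
  have hσ' : AEMeasurable (fun x => ENNReal.ofReal √(supEmpSq 𝓕 x)) μ := hσm.sqrt.ennreal_ofReal
  have hB' : AEMeasurable (fun x : Fin n → X => ENNReal.ofReal √(‖sampleVec Fenv x‖ ^ 2 / n)) μ :=
    hTBm.sqrt.ennreal_ofReal.aemeasurable
  have hpt : ∀ x : Fin n → X, ∑ e : Fin n → Bool, signSup 𝓖 (fun i => rad (e i)) x ≤
      2 ^ n * (ENNReal.ofReal (18 * L * √(n : ℝ)) * J) * (ENNReal.ofReal (1 / δ) *
        ENNReal.ofReal √(supEmpSq 𝓕 x) + ENNReal.ofReal √(‖sampleVec Fenv x‖ ^ 2 / n)) := by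
    intro x
    refine (Finset.sum_le_sum fun e _ => hG _ x).trans ?_
    refine (sum_iSup_radSum_comp_le hn x hne hm henv hF1 hL hφ hφ0 hδ
      fun f hf => norm_sampleVec_le_supEmpSq hn hb x hf).trans (le_of_eq ?_)
    rw [← ENNReal.ofReal_mul (by positivity),
      ← ENNReal.ofReal_add (by positivity) (by positivity), hTB0,
      ENNReal.ofReal_mul (by positivity), one_div_mul_eq_div]
    ring
  have hint : ∑ e : Fin n → Bool, ∫⁻ x, signSup 𝓖 (fun i => rad (e i)) x ∂μ ≤
      2 ^ n * (ENNReal.ofReal (18 * L * √(n : ℝ)) * J) *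
        ENNReal.ofReal (√(∫ x, supEmpSq 𝓕 x ∂μ) / δ + √(∫ y, Fenv y ^ 2 ∂P)) := by
    rw [← lintegral_finsetSum' _ fun e _ => hGP.aemeasurable_signSup fun i => rad_eq (e i)]
    have hadd : AEMeasurable (fun x => ENNReal.ofReal (1 / δ) * ENNReal.ofReal √(supEmpSq 𝓕 x) +
        ENNReal.ofReal √(‖sampleVec Fenv x‖ ^ 2 / n)) μ := (hσ'.const_mul _).add hB'
    refine (lintegral_mono (μ := μ) hpt).trans ?_
    rw [lintegral_const_mul'' _ hadd]
    gcongr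
    rw [lintegral_add_left' (hσ'.const_mul _), lintegral_const_mul'' _ hσ']
    have h1 := lintegral_ofReal_sqrt_le hσm (supEmpSq_nonneg 𝓕) (supEmpSq_le_one hb)
    have h2 := lintegral_ofReal_sqrt_le hTBm.aemeasurable (μ := μ)
      (fun x => by positivity) hTB1
    rw [integral_sampleVec_sq hn henv.1 hFabs] at h2
    rw [ENNReal.ofReal_add (by positivity) (by positivity), ← one_div_mul_eq_div δ (√_),
      ENNReal.ofReal_mul (by positivity)]
    gcongr
  have hsym : (2 : ℝ≥0∞) ^ n * outerExpectation μ (empiricalSup P n 𝓖) ≤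
      ENNReal.ofReal (1 / √(n : ℝ)) *
        (2 * ∑ e : Fin n → Bool, ∫⁻ x, signSup 𝓖 (fun i => rad (e i)) x ∂μ) := by
    have h1 : ∑ _e : Fin n → Bool, outerExpectation μ (empiricalSup P n 𝓖) =
        (2 : ℝ≥0∞) ^ n * outerExpectation μ (empiricalSup P n 𝓖) := by
      simp
    rw [← h1, Finset.mul_sum, Finset.mul_sum]
    exact Finset.sum_le_sum fun e _ =>
      outerExpectation_empiricalSup_le hGm hGb hGP fun i => rad_eq (e i)
  have h2n : (2 : ℝ≥0∞) ^ n ≠ 0 := by simp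
  have h2n' : (2 : ℝ≥0∞) ^ n ≠ ⊤ := by simp
  rw [← ENNReal.mul_le_mul_iff_right h2n h2n']
  refine (hsym.trans (mul_le_mul_right (mul_le_mul_right hint _) _)).trans (le_of_eq ?_)
  set W := √(∫ x, supEmpSq 𝓕 x ∂μ) / δ + √(∫ y, Fenv y ^ 2 ∂P) with hW
  have hW0 : 0 ≤ W := by positivity
  have hc : ENNReal.ofReal (1 / √(n : ℝ)) * 2 * ENNReal.ofReal (18 * L * √(n : ℝ)) *
      ENNReal.ofReal W = ENNReal.ofReal (36 * L * W) := by
    rw [← ENNReal.ofReal_ofNat 2, ← ENNReal.ofReal_mul (by positivity),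
      ← ENNReal.ofReal_mul (by positivity), ← ENNReal.ofReal_mul (by positivity)]
    congr 1
    field_simp
    ring
  rw [← hc]
  ring

end Bounds

end EmpProc

open EmpProc in
theorem theorem1 :
    ∃ C : ℝ≥0, ∀ (X : Type*) [MeasurableSpace X] (P : Measure X) [IsProbabilityMeasure P]
      (𝓕 : Set (X → ℝ)) (Fenv : X → ℝ) (δ : ℝ) (n : ℕ),
      (∀ f ∈ 𝓕, Measurable f) →
      EmpProc.PMeasurable P 𝓕 →
      EmpProc.PMeasurable P (EmpProc.sqClass 𝓕) →
      EmpProc.IsEnvelope 𝓕 Fenv →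
      (∀ x, Fenv x ≤ 1) →
      0 < δ → δ < 1 →
      (∀ f ∈ 𝓕, ∫ x, f x ^ 2 ∂P < δ ^ 2 * ∫ x, Fenv x ^ 2 ∂P) →
      1 ≤ n →
      EmpProc.outerExpectation (Measure.pi fun _ : Fin n => P) (EmpProc.empiricalSup P n 𝓕) ≤
        C * (EmpProc.uniformEntropyIntegral δ 𝓕 Fenv *
          (1 + EmpProc.uniformEntropyIntegral δ 𝓕 Fenv /
            (ENNReal.ofReal (δ ^ 2 * √(n : ℝ)) * eLpNorm Fenv 2 P)) *
          eLpNorm Fenv 2 P) := by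
  refine ⟨5184, fun X _ P _ 𝓕 Fenv δ n hm hP hsq henv hF1 hδ _ hsmall hn1 => ?_⟩
  have hn : n ≠ 0 := by omega
  have hsn : (0 : ℝ) < √(n : ℝ) := Real.sqrt_pos.2 (by exact_mod_cast hn1)
  rcases 𝓕.eq_empty_or_nonempty with rfl | hne
  · refine (iInf₂_le (fun _ => 0) measurable_const).trans ((iInf_le _ ?_).trans ?_)
    · intro x
      simp [empiricalSup]
    · simp
  have hb : ∀ f ∈ 𝓕, ∀ y, |f y| ≤ 1 := fun f hf y => (henv.2 f hf y).trans (hF1 y)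
  set J := uniformEntropyIntegral δ 𝓕 Fenv with hJ
  set A := √(∫ y, Fenv y ^ 2 ∂P) with hA
  set μ := Measure.pi fun _ : Fin n => P with hμ
  have hApos : 0 < A := by
    obtain ⟨f, hf⟩ := hne
    have h1 : 0 < δ ^ 2 * ∫ y, Fenv y ^ 2 ∂P :=
      lt_of_le_of_lt (integral_nonneg fun y => sq_nonneg (f y)) (hsmall f hf)
    exact Real.sqrt_pos.2 (pos_of_mul_pos_right h1 (by positivity))
  have hA2 : ∫ y, Fenv y ^ 2 ∂P = A ^ 2 :=
    (Real.sq_sqrt (integral_nonneg fun y => sq_nonneg _)).symm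
  have hFA : eLpNorm Fenv 2 P = ENNReal.ofReal A := by
    have hmem : MemLp Fenv 2 P := by
      refine MemLp.of_bound henv.1.aestronglyMeasurable 1 (Filter.Eventually.of_forall fun y => ?_)
      obtain ⟨f, hf⟩ := hne
      rw [Real.norm_of_nonneg ((abs_nonneg _).trans (henv.2 f hf y))]
      exact hF1 y
    rw [hmem.eLpNorm_eq_integral_rpow_norm (by norm_num) (by norm_num), hA, Real.sqrt_eq_rpow]
    norm_num
  set Z := √(∫ x, supEmpSq 𝓕 x ∂μ) with hZ
  have hZ2 : ∫ x, supEmpSq 𝓕 x ∂μ = Z ^ 2 :=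
    (Real.sq_sqrt (integral_nonneg fun y => supEmpSq_nonneg 𝓕 y)).symm
  have hbound : outerExpectation μ (empiricalSup P n 𝓕) ≤
      ENNReal.ofReal (36 * (Z / δ + A)) * J := by
    have := outerExpectation_empiricalSup_comp_le (P := P) (𝓖 := 𝓕) (φ := id) (L := 1) hne hm hsq
      henv hF1 one_pos (fun a b => by simp) rfl hm hb hP hn (fun e x => le_rfl) hδ
    rwa [mul_one] at this
  by_cases hJtop : J = ⊤
  · rw [hJtop, hFA, ENNReal.top_mul (by simp), ENNReal.top_mul (by simpa using hApos),
      ENNReal.mul_top (by norm_num)]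
    exact le_top
  have hboundsq : outerExpectation μ (empiricalSup P n (sqClass 𝓕)) ≤
      ENNReal.ofReal (72 * (Z / δ + A)) * J := by
    have := outerExpectation_empiricalSup_comp_le (P := P) (𝓖 := sqClass 𝓕)
      (φ := fun t => (max (-1) (min t 1)) ^ 2) (L := 2) hne hm hsq henv hF1 two_pos
      abs_clip_sq_sub_le (by norm_num)
      (by rintro g ⟨f, hf, rfl⟩; exact (hm f hf).pow_const 2)
      (by
        rintro g ⟨f, hf, rfl⟩ y
        rw [abs_of_nonneg (sq_nonneg _)]
        exact (sq_le_one_iff_abs_le_one _).2 (hb f hf y)) hsq hn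
      (fun e x => by
        rw [signSup_sqClass]
        refine iSup₂_mono fun f hf => le_of_eq ?_
        congr 2
        exact Finset.sum_congr rfl fun i _ => by rw [clip_eq_self (hb f hf _)]) hδ
    rwa [show (36 : ℝ) * 2 = 72 by norm_num] at this
  obtain ⟨j, hj0, hj⟩ : ∃ j : ℝ, 0 ≤ j ∧ J = ENNReal.ofReal j :=
    ⟨J.toReal, ENNReal.toReal_nonneg, (ENNReal.ofReal_toReal hJtop).symm⟩
  rw [hj, ← ENNReal.ofReal_mul (by positivity)] at hbound hboundsq
  have hZle : Z ^ 2 ≤ δ ^ 2 * A ^ 2 + 1 / √(n : ℝ) * (72 * (Z / δ + A) * j) := by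
    have hi : Integrable (supEmpSq 𝓕) μ :=
      Integrable.of_bound (aemeasurable_supEmpSq hsq).aestronglyMeasurable 1
        (Filter.Eventually.of_forall fun x => by
          rw [Real.norm_of_nonneg (supEmpSq_nonneg 𝓕 x)]
          exact supEmpSq_le_one hb x)
    have h1 := lintegral_le_add_mul_outerExpectation (μ := μ)
      (b := ENNReal.ofReal (1 / √(n : ℝ))) (by simpa using hsn) ENNReal.ofReal_ne_top
      (ofReal_supEmpSq_le (P := P) hn hb fun f hf => (hsmall f hf).le)
    rw [← ofReal_integral_eq_lintegral_ofReal hi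
      (Filter.Eventually.of_forall fun x => supEmpSq_nonneg 𝓕 x), hZ2, hA2] at h1
    have h2 := h1.trans (add_le_add_right (mul_le_mul_right hboundsq _) _)
    rw [← ENNReal.ofReal_mul (by positivity),
      ← ENNReal.ofReal_add (by positivity) (by positivity)] at h2
    exact (ENNReal.ofReal_le_ofReal_iff (by positivity)).1 h2
  have hfinal := add_le_of_sq_le hApos hδ hsn hj0 (Real.sqrt_nonneg _) hZle
  refine hbound.trans ((ENNReal.ofReal_le_ofReal hfinal).trans (le_of_eq ?_))
  have h5184 : ENNReal.ofReal 5184 = ((5184 : ℝ≥0) : ℝ≥0∞) := by norm_num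
  rw [hFA, hj, ENNReal.ofReal_mul (by norm_num), ENNReal.ofReal_mul (by positivity),
    ENNReal.ofReal_mul hj0, ENNReal.ofReal_add zero_le_one (by positivity), ENNReal.ofReal_one,
    ENNReal.ofReal_div_of_pos (by positivity), ENNReal.ofReal_mul (by positivity), h5184]
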